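/- A decompressor is a partial computable function $U$ on binary strings; it is optimal if for every decompressor $V$ there is a constant $c$ such that, whenever $V(p)=x$, there is a program $q$ with $U(q)=x$ and $|q|\le |p|+c$. The (plain) Kolmogorov complexity of a string $x$ is $K(x)=\min\{|p| : U(p)=x\}$, where $U$ is an optimal decompressor. For an infinite binary sequence $\omega=\omega_0\omega_1\omega_2\dots$ write $\omega([k,k+n))$ for the substring $\omega_k\omega_{k+1}\dots\omega_{k+n-1}$. The sequence $\omega$ is $\alpha$-everywhere complex if there is a constant $c$ such that $K(\omega([k,k+n)))\ge \alpha n-c$ for all natural numbers $k$ and $n$; it is everywhere complex if it is $\alpha$-everywhere complex for some real $\alpha\in(0,1)$. A sequence is Martin-Löf random (with respect to the fair coin measure $\mu$ on $\{0,1\}^{\mathbb N}$) if it does not belong to $\bigcap_n G_n$ for any Martin-Löf test $(G_n)$, that is, for any uniformly computably enumerable sequence of open sets $G_n$ with $\mu(G_n)\le 2^{-n}$ for all $n\in\mathbb N$. A mass problem is a set of infinite binary sequences; $\mathcal P$ is Muchnik (non-uniformly) reducible to $\mathcal Q$ if for every $\omega\in\mathcal Q$ there is an oracle machine that, given $\omega$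 as oracle, computes an element of $\mathcal P$. Theorem. For every choice of the optimal decompressor $U$, the mass problem "produce an everywhere complex sequence" is not Muchnik reducible to the mass problem "produce a Martin-Löf random sequence": there is a Martin-Löf random sequence that computes no everywhere complex sequence. -/

import Mathlib

open scoped ENNReal

noncomputable section

namespace KolmogorovRandom

/-- Infinite binary sequences: the points of Cantor space. -/
abbrev BinSeq : Type := ℕ → Bool

/-- The substring `ω([k, k + n)) = ω_k ω_{k+1} … ω_{k+n-1}` of an infinite binary sequence. -/
def substring (ω : BinSeq) (k n : ℕ) : List Bool :=
  (List.range n).map fun i => ω (k + i)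

/-! ### Kolmogorov complexity -/

/-- A decompressor (a partial computable function on binary strings) is optimal if, for every
other decompressor `V`, it has programs that are longer by at most an additive constant. -/
def IsOptimal (U : List Bool →. List Bool) : Prop :=
  Partrec U ∧ ∀ V : List Bool →. List Bool, Partrec V →
    ∃ c : ℕ, ∀ p x : List Bool, x ∈ V p → ∃ q : List Bool, x ∈ U q ∧ q.length ≤ p.length + c

/-- The (plain) Kolmogorov complexity of `x` with respect to the decompressor `U`: the minimal
length of a program that produces `x`. For an optimal `U` every string has a program, see
`IsOptimal.exists_program`. -/
def complexity (U : List Bool →. List Bool) (x : List Bool) : ℕ :=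
  sInf {l : ℕ | ∃ p : List Bool, x ∈ U p ∧ p.length = l}

theorem IsOptimal.exists_program {U : List Bool →. List Bool} (hU : IsOptimal U) (x : List Bool) :
    ∃ p : List Bool, x ∈ U p := by
  obtain ⟨c, hc⟩ := hU.2 (fun p => Part.some p) Partrec.some
  obtain ⟨q, hq, -⟩ := hc x x (Part.mem_some x)
  exact ⟨q, hq⟩

/-- Optimal decompressors exist (Solomonoff–Kolmogorov): read `e` zeros and a one, and run the
`e`-th program on the rest of the input. -/
theorem exists_isOptimal : ∃ U : List Bool →. List Bool, IsOptimal U := by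
  let rest : List Bool → List Bool := fun p => List.tail^[p.findIdx id + 1] p
  let U : List Bool →. List Bool := fun p =>
    ((Denumerable.ofNat Nat.Partrec.Code (p.findIdx id)).eval (Encodable.encode (rest p))).bind
      fun m => ((Encodable.decode m : Option (List Bool)) : Part (List Bool))
  have hidx : Computable fun p : List Bool => p.findIdx id :=
    (Primrec.list_findIdx Primrec.id (Primrec.snd.to₂)).to_comp
  have hrest : Computable rest :=
    (Primrec.nat_iterate
      (Primrec.succ.comp (Primrec.list_findIdx Primrec.id (Primrec.snd.to₂)))
      Primrec.id (Primrec.list_tail.comp Primrec.snd).to₂).to_comp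
  refine ⟨U, ?_, ?_⟩
  · refine Partrec.bind (Nat.Partrec.Code.eval_part.comp
      ((Computable.ofNat Nat.Partrec.Code).comp hidx) (Computable.encode.comp hrest)) ?_
    exact (Computable.ofOption (Computable.decode.comp Computable.snd)).to₂
  · intro V hV
    obtain ⟨code, hcode⟩ := Nat.Partrec.Code.exists_code.1 hV
    refine ⟨Encodable.encode code + 1, fun p x hx => ?_⟩
    have h1 : ∀ e : ℕ, (List.replicate e false ++ true :: p).findIdx id = e := by
      intro e
      induction e with
      | zero => simp [List.findIdx_cons]
      | succ e ih => simp [List.replicate_succ, List.findIdx_cons, ih]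
    have h2 : ∀ e : ℕ, List.tail^[e + 1] (List.replicate e false ++ true :: p) = p := by
      intro e
      induction e with
      | zero => simp
      | succ e ih => rw [Function.iterate_succ_apply]; simpa [List.replicate_succ] using ih
    refine ⟨List.replicate (Encodable.encode code) false ++ true :: p, ?_, by simp; omega⟩
    simp only [U, rest, h1, h2, Denumerable.ofNat_encode, hcode]
    simp [hx]

/-- `ω` is `α`-everywhere complex: `K(ω([k, k + n))) ≥ α n - c` for some constant `c` and for all
natural numbers `k` and `n`. -/
def IsEverywhereComplexWith (U : List Bool →. List Bool) (α : ℝ) (ω : BinSeq) : Prop :=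
  ∃ c : ℝ, ∀ k n : ℕ, α * n - c ≤ complexity U (substring ω k n)

/-- The mass problem of producing a sequence that is `α`-everywhere complex for some real
`α ∈ (0, 1)`. -/
def everywhereComplex (U : List Bool →. List Bool) : Set BinSeq :=
  {ω | ∃ α : ℝ, 0 < α ∧ α < 1 ∧ IsEverywhereComplexWith U α ω}

/-! ### Martin-Löf randomness -/

/-- The fair coin (uniform Bernoulli) measure on Cantor space. -/
def coinMeasure : MeasureTheory.Measure BinSeq :=
  MeasureTheory.Measure.infinitePi fun _ : ℕ => (PMF.uniformOfFintype Bool).toMeasure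

/-- The open set of all infinite sequences that have a prefix in the set of strings `S`. -/
def openSet (S : Set (List Bool)) : Set BinSeq :=
  {ω | ∃ s ∈ S, substring ω 0 s.length = s}

/-- A Martin-Löf test: a uniformly computably enumerable sequence of sets of strings whose `n`-th
term generates an open set of uniform measure at most `2⁻ⁿ`. -/
structure IsMartinLofTest (W : ℕ → Set (List Bool)) : Prop where
  re : REPred fun p : ℕ × List Bool => p.2 ∈ W p.1
  measure_le : ∀ n : ℕ, coinMeasure (openSet (W n)) ≤ 2⁻¹ ^ n

/-- The mass problem of producing a Martin-Löf random sequence (with respect to the fair coin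
measure): the sequences that pass every Martin-Löf test. -/
def martinLofRandom : Set BinSeq :=
  {ω | ∀ W : ℕ → Set (List Bool), IsMartinLofTest W → ∃ n : ℕ, ω ∉ openSet (W n)}

/-! ### Muchnik reducibility -/

/-- An infinite binary sequence, as an oracle. -/
def toOracle (ω : BinSeq) : ℕ →. ℕ :=
  fun n => Part.some (ω n).toNat

/-- `P` is Muchnik (non-uniformly, weakly) reducible to `Q`: for every `ω ∈ Q` some oracle machine
transforms `ω` to an element of `P`. -/
def MuchnikReducible (P Q : Set BinSeq) : Prop :=
  ∀ ω ∈ Q, ∃ τ ∈ P, ComputableIn {toOracle ω} τ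

end KolmogorovRandom

end

noncomputable section

namespace KolmogorovRandom

/-! ### Combinatorics: few strings that meet most sequences -/

/-! Almost every sequence is Martin-Löf random, while almost no sequence computes an everywhere
complex one (`measure_computes_everywhereComplex`); so some random sequence computes none. Since
functionals are countable, it suffices to treat one functional `G` and one bound `|a| ≤ M * (K(a) +
c)` for the factors `a` of its output (`IsFunctional.measure_complex_eq_zero`).

The core is combinatorial (`exists_sparse_meeting`). For large `N`, every finite family of sequences
has a list `A` such that nearly every sequence of the family contains a member of `A` early on,
although each `a` in `A` has an index below `2 ^ (|a| / M - 2 * t)`. The number of factors of a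
given length grows at a bounded exponential rate, so on passing to longer and longer factors this
rate can fall noticeably only finitely often. Where it does not fall, the long factors fill a fair
share of the concatenations of short ones, and a few greedily chosen concatenations hit most
sequences of this kind.

Suppose that `G` yields complex sequences with positive probability. The measure of the oracles on
which `G` yields `N` symbols decreases to a limit `p`; a rational just below `p` is enough
information for a program to find, for each `t`, a length and a list `A` that works for most
outputs. A member `a` of `A` is then described by `t` and its index in about `|a| / M - t` bits, too
few for a factor of a complex sequence once `t` is large. So the complex outputs avoid `A`, and
their oracles have too small a measure. -/

theorem length_substring (ω : BinSeq) (k n : ℕ) : (substring ω k n).length = n := by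
  simp [substring]

theorem substring_add (ω : BinSeq) (k m n : ℕ) :
    substring ω k (m + n) = substring ω k m ++ substring ω (k + m) n := by
  simp [substring, List.range_add, Function.comp_def, add_assoc]

/-- The strings of length `n` that occur in the first `N` places of `ω`. -/
def factors (ω : BinSeq) (N n : ℕ) : Finset (List Bool) :=
  (Finset.range (N + 1 - n)).image fun k => substring ω k n

theorem mem_factors {ω : BinSeq} {N n : ℕ} {a : List Bool} :
    a ∈ factors ω N n ↔ ∃ k, k + n ≤ N ∧ substring ω k n = a := by
  simp only [factors, Finset.mem_image, Finset.mem_range]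
  refine exists_congr fun k => and_congr_left fun _ => ?_
  omega

/-- Some member of the list `A` occurs in the first `N` places of `ω`. -/
def Meets (ω : BinSeq) (N : ℕ) (A : List (List Bool)) : Prop :=
  ∃ a ∈ A, a ∈ factors ω N a.length

instance (ω : BinSeq) (N : ℕ) (A : List (List Bool)) : Decidable (Meets ω N A) :=
  inferInstanceAs (Decidable (∃ a ∈ A, a ∈ factors ω N a.length))

/-- The strings of length `n`. -/
def strings : ℕ → List (List Bool)
  | 0 => [[]]
  | n + 1 => (strings n).flatMap fun l => [false :: l, true :: l]

theorem mem_strings {n : ℕ} {l : List Bool} : l ∈ strings n ↔ l.length = n := by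
  induction n generalizing l with
  | zero => simp [strings]
  | succ n ih =>
    cases l with
    | nil => simp [strings]
    | cons b l => cases b <;> simp [strings, ih]

theorem length_strings (n : ℕ) : (strings n).length = 2 ^ n := by
  induction n with
  | zero => simp [strings]
  | succ n ih => simp [strings, List.length_flatMap, ih, pow_succ]

theorem nodup_strings (n : ℕ) : (strings n).Nodup := by
  induction n with
  | zero => simp [strings]
  | succ n ih =>
    rw [strings, List.nodup_flatMap]
    refine ⟨fun l _ => by simp, ih.imp ?_⟩
    intro a b hab
    simp [Function.onFun, hab.symm]

theorem factors_subset_strings (ω : BinSeq) (N n : ℕ) :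
    factors ω N n ⊆ (strings n).toFinset := by
  intro a ha
  obtain ⟨k, -, rfl⟩ := mem_factors.1 ha
  simp [mem_strings, length_substring]

theorem card_factors_le (ω : BinSeq) (N n : ℕ) : (factors ω N n).card ≤ 2 ^ n :=
  (Finset.card_le_card (factors_subset_strings ω N n)).trans
    ((List.toFinset_card_le _).trans (length_strings n).le)

/-- The concatenations of `q` members of `F`. -/
def concatenations (F : Finset (List Bool)) : ℕ → Finset (List Bool)
  | 0 => {[]}
  | q + 1 => Finset.image₂ (· ++ ·) F (concatenations F q)

theorem card_concatenations_le (F : Finset (List Bool)) (q : ℕ) :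
    (concatenations F q).card ≤ F.card ^ q := by
  induction q with
  | zero => simp [concatenations]
  | succ q ih =>
    rw [concatenations, pow_succ']
    exact (Finset.card_image₂_le _ _ _).trans (Nat.mul_le_mul_left _ ih)

theorem length_of_mem_concatenations {F : Finset (List Bool)} {n : ℕ}
    (hF : ∀ a ∈ F, a.length = n) {q : ℕ} {a : List Bool} (ha : a ∈ concatenations F q) :
    a.length = q * n := by
  induction q generalizing a with
  | zero => simp_all [concatenations]
  | succ q ih =>
    obtain ⟨b, hb, c, hc, rfl⟩ := Finset.mem_image₂.1 ha
    rw [List.length_append, hF b hb, ih hc]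
    ring

theorem substring_mem_concatenations (ω : BinSeq) (N n q k : ℕ) (h : k + q * n ≤ N) :
    substring ω k (q * n) ∈ concatenations (factors ω N n) q := by
  induction q generalizing k with
  | zero => simp [concatenations, substring]
  | succ q ih =>
    have e : (q + 1) * n = n + q * n := by ring
    rw [e] at h ⊢
    rw [substring_add, concatenations]
    exact Finset.mem_image₂_of_mem (mem_factors.2 ⟨k, by omega, rfl⟩) (ih _ (by omega))

theorem factors_subset_concatenations (ω : BinSeq) (N n q : ℕ) :
    factors ω N (q * n) ⊆ concatenations (factors ω N n) q := by
  intro a ha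
  obtain ⟨k, hk, rfl⟩ := mem_factors.1 ha
  exact substring_mem_concatenations ω N n q k hk

/-! ### Greedy hitting sets -/

/-- A most frequent point of a family of large subsets of a small set. -/
theorem exists_frequent_point {ι β : Type*} [DecidableEq β] (J : Finset ι) (S : ι → Finset β)
    (Y : Finset β) (ρ : ℕ) (hS : ∀ j ∈ J, S j ⊆ Y) (hY : ∀ j ∈ J, Y.card ≤ ρ * (S j).card)
    (hY0 : Y.Nonempty) :
    ∃ a ∈ Y, J.card ≤ ρ * (J.filter fun j => a ∈ S j).card := by
  by_contra! hcon
  have h1 : ∑ a ∈ Y, ρ * (J.filter fun j => a ∈ S j).card < ∑ a ∈ Y, J.card :=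
    Finset.sum_lt_sum_of_nonempty hY0 hcon
  -- Double count of the pairs `(a, j)` with `a ∈ S j`.
  have h2 : ∑ a ∈ Y, (J.filter fun j => a ∈ S j).card = ∑ j ∈ J, (S j).card := by
    refine (Finset.sum_card_bipartiteAbove_eq_sum_card_bipartiteBelow
      (fun a j => a ∈ S j)).trans ?_
    refine Finset.sum_congr rfl fun j hj => ?_
    congr 1
    ext a
    simp only [Finset.bipartiteBelow, Finset.mem_filter]
    exact ⟨fun h => h.2, fun h => ⟨hS j hj h, h⟩⟩
  have h3 : ∑ j ∈ J, Y.card ≤ ∑ j ∈ J, ρ * (S j).card := Finset.sum_le_sum hY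
  rw [← Finset.mul_sum, h2, Finset.mul_sum] at h1
  simp only [Finset.sum_const, smul_eq_mul] at h1 h3
  rw [mul_comm] at h3
  omega

/-- Greedy choice of points that meet most members of a family of large subsets. -/
theorem exists_list_meeting_most {ι β : Type*} [DecidableEq β] (J : Finset ι) (S : ι → Finset β)
    (Y : Finset β) (ρ : ℕ) (hS : ∀ j ∈ J, S j ⊆ Y) (hY : ∀ j ∈ J, Y.card ≤ ρ * (S j).card)
    (s : ℕ) :
    ∃ A : List β, A.length ≤ s ∧ (∀ a ∈ A, a ∈ Y) ∧ (Y.Nonempty →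
      ρ ^ s * (J.filter fun j => ∀ a ∈ A, a ∉ S j).card ≤ (ρ - 1) ^ s * J.card) := by
  -- Nonemptiness of `Y` is assumed only inside the conclusion, so that a list exists for every `Y`
  -- and can be chosen for all factor sets at once.
  rcases Y.eq_empty_or_nonempty with rfl | hY0
  · exact ⟨[], by simp⟩
  induction s with
  | zero => exact ⟨[], by simp⟩
  | succ s ih =>
    obtain ⟨A, hA1, hA2, hA3⟩ := ih
    specialize hA3 hY0
    -- `K` is the part not yet met. A point frequent in `K` shrinks it by the factor `1 - 1 / ρ`.
    set K := J.filter fun j => ∀ a ∈ A, a ∉ S j with hK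
    obtain ⟨a, ha, hcard⟩ := exists_frequent_point K S Y ρ
      (fun j hj => hS j (Finset.mem_filter.1 hj).1)
      (fun j hj => hY j (Finset.mem_filter.1 hj).1) hY0
    refine ⟨a :: A, by simpa using hA1, by simpa [ha] using hA2, fun _ => ?_⟩
    have h1 : (J.filter fun j => ∀ b ∈ a :: A, b ∉ S j) = K.filter fun j => a ∉ S j := by
      ext j
      simp only [hK, Finset.mem_filter, List.forall_mem_cons]
      tauto
    have h2 := Finset.card_filter_add_card_filter_not (s := K) (fun j => a ∈ S j)
    rw [h1]
    set u := (K.filter fun j => a ∉ S j).card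
    have h3 : ρ * u ≤ (ρ - 1) * K.card := by
      rw [Nat.sub_mul, one_mul, ← h2, mul_add]
      omega
    calc ρ ^ (s + 1) * u = ρ ^ s * (ρ * u) := by ring
      _ ≤ ρ ^ s * ((ρ - 1) * K.card) := Nat.mul_le_mul_left _ h3
      _ = (ρ - 1) * (ρ ^ s * K.card) := by ring
      _ ≤ (ρ - 1) * ((ρ - 1) ^ s * J.card) := Nat.mul_le_mul_left _ hA3
      _ = (ρ - 1) ^ (s + 1) * J.card := by ring

/-- Two leading terms of the binomial expansion. -/
theorem pow_add_mul_pow_le (r n : ℕ) : r ^ (n + 1) + (n + 1) * r ^ n ≤ (r + 1) ^ (n + 1) := by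
  induction n with
  | zero => simp
  | succ n ih =>
    calc r ^ (n + 1 + 1) + (n + 1 + 1) * r ^ (n + 1)
        ≤ (r ^ (n + 1) + (n + 1) * r ^ n) * (r + 1) := by
          rw [show (r ^ (n + 1) + (n + 1) * r ^ n) * (r + 1) =
            r ^ (n + 1 + 1) + (n + 1 + 1) * r ^ (n + 1) + (n + 1) * r ^ n by ring]
          exact Nat.le_add_right _ _
      _ ≤ (r + 1) ^ (n + 1) * (r + 1) := Nat.mul_le_mul_right _ ih
      _ = (r + 1) ^ (n + 1 + 1) := by ring

/-- This is `(1 - 1 / ρ) ^ ρ ≤ 1 / 2`: `ρ` greedy choices halve the part that is not met. -/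
theorem two_mul_pred_pow_le (ρ : ℕ) (hρ : 1 ≤ ρ) : 2 * (ρ - 1) ^ ρ ≤ ρ ^ ρ := by
  obtain ⟨r, rfl⟩ := Nat.exists_eq_add_of_le' hρ
  rw [Nat.add_sub_cancel]
  refine le_trans ?_ (pow_add_mul_pow_le r r)
  rw [two_mul]
  refine Nat.add_le_add_left ?_ _
  rw [pow_succ']
  exact Nat.mul_le_mul_right _ (Nat.le_succ r)

/-- If the strings of length `q * n` that occur in `x j` are a fair share of the concatenations of
strings of length `n` that occur there, then few strings of length `q * n` meet most `x j`. -/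
theorem exists_list_meeting_diverse {ι : Type*} (J : Finset ι) (x : ι → BinSeq)
    (N n q r d : ℕ) (hN : q * n ≤ N)
    (hJ : ∀ j ∈ J, (factors (x j) N n).card ^ q ≤ 2 ^ r * (factors (x j) N (q * n)).card) :
    ∃ A : List (List Bool), A.length ≤ 2 ^ 2 ^ n * (2 ^ r * d) ∧ (∀ a ∈ A, a.length = q * n) ∧
      2 ^ d * (J.filter fun j => ¬ Meets (x j) N A).card ≤ J.card := by
  classical
  -- The family is split by the set `F` of short factors. Within `T F` all sets of long factors lie
  -- in the single set `concatenations F q`, as the greedy choice requires. The number of possible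
  -- `F` depends on `n` alone.
  let P : Finset (Finset (List Bool)) := (strings n).toFinset.powerset
  let T : Finset (List Bool) → Finset ι := fun F => J.filter fun j => factors (x j) N n = F
  have hgreedy := fun F : Finset (List Bool) => exists_list_meeting_most (T F)
    (fun j => factors (x j) N (q * n)) (concatenations F q) (2 ^ r)
    (fun j hj => by
      rw [← (Finset.mem_filter.1 hj).2]
      exact factors_subset_concatenations _ _ _ _)
    (fun j hj => by
      rw [← (Finset.mem_filter.1 hj).2]
      exact (card_concatenations_le _ _).trans (hJ j (Finset.mem_filter.1 hj).1))
    (2 ^ r * d)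
  choose A hA1 hA2 hA3 using hgreedy
  have hlen : ∀ F ∈ P, ∀ a ∈ A F, a.length = q * n := by
    intro F hF a ha
    refine length_of_mem_concatenations (fun b hb => ?_) (hA2 F a ha)
    exact mem_strings.1 (List.mem_toFinset.1 (Finset.mem_powerset.1 hF hb))
  have hcardP : P.card = 2 ^ 2 ^ n := by
    rw [Finset.card_powerset, List.toFinset_card_of_nodup (nodup_strings n), length_strings]
  refine ⟨P.toList.flatMap A, ?_, ?_, ?_⟩
  · rw [List.length_flatMap, ← hcardP, ← Finset.length_toList, ← smul_eq_mul]
    refine (List.sum_le_card_nsmul _ (2 ^ r * d) ?_).trans (by rw [List.length_map])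
    simp only [List.mem_map]
    rintro _ ⟨F, -, rfl⟩
    exact hA1 F
  · intro a ha
    obtain ⟨F, hF, ha⟩ := List.mem_flatMap.1 ha
    exact hlen F (Finset.mem_toList.1 hF) a ha
  · have hmaps : ∀ j, factors (x j) N n ∈ P :=
      fun j => Finset.mem_powerset.2 (factors_subset_strings _ _ _)
    rw [Finset.card_eq_sum_card_fiberwise (f := fun j => factors (x j) N n) (t := P)
      (fun j _ => hmaps j), Finset.card_eq_sum_card_fiberwise (s := J)
      (f := fun j => factors (x j) N n) (t := P) (fun j _ => hmaps j), Finset.mul_sum]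
    refine Finset.sum_le_sum fun F hF => ?_
    have hsub : ((J.filter fun j => ¬ Meets (x j) N (P.toList.flatMap A)).filter
        fun j => factors (x j) N n = F) ⊆
        (T F).filter fun j => ∀ a ∈ A F, a ∉ factors (x j) N (q * n) := by
      intro j hj
      simp only [T, Finset.mem_filter] at hj ⊢
      refine ⟨⟨hj.1.1, hj.2⟩, fun a ha hmem => hj.1.2 ⟨a, ?_, ?_⟩⟩
      · exact List.mem_flatMap.2 ⟨F, Finset.mem_toList.2 hF, ha⟩
      · rwa [hlen F hF a ha]
    refine (Nat.mul_le_mul_left _ (Finset.card_le_card hsub)).trans ?_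
    change _ ≤ (T F).card
    rcases (T F).eq_empty_or_nonempty with hT | ⟨j, hj⟩
    · simp [hT]
    have hY : (concatenations F q).Nonempty := by
      rw [← (Finset.mem_filter.1 hj).2]
      exact ⟨_, substring_mem_concatenations (x j) N n q 0 (by omega)⟩
    have h := hA3 F hY
    -- Each of `d` rounds of `2 ^ r` choices halves the remainder.
    have h2 := Nat.pow_le_pow_left (two_mul_pred_pow_le (2 ^ r) Nat.one_le_two_pow) d
    rw [mul_pow, ← pow_mul, ← pow_mul] at h2
    refine Nat.le_of_mul_le_mul_left (c := (2 ^ r) ^ (2 ^ r * d)) ?_ (by positivity)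
    calc (2 ^ r) ^ (2 ^ r * d) * (2 ^ d * ((T F).filter
          fun j => ∀ a ∈ A F, a ∉ factors (x j) N (q * n)).card)
        = 2 ^ d * ((2 ^ r) ^ (2 ^ r * d) * ((T F).filter
          fun j => ∀ a ∈ A F, a ∉ factors (x j) N (q * n)).card) := by ring
      _ ≤ 2 ^ d * ((2 ^ r - 1) ^ (2 ^ r * d) * (T F).card) := Nat.mul_le_mul_left _ h
      _ = (2 ^ d * (2 ^ r - 1) ^ (2 ^ r * d)) * (T F).card := by ring
      _ ≤ (2 ^ r) ^ (2 ^ r * d) * (T F).card := Nat.mul_le_mul_right _ h2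

/-! ### Descent on the growth rate of the factors -/

/-- Every member `a` of the list has an index below `2 ^ (|a| / M - 2 * t)`. -/
def IsSparse (M t : ℕ) (A : List (List Bool)) : Prop :=
  ∀ i < A.length, i + 1 < 2 ^ ((A.getD i []).length / M - 2 * t)

/-- Earlier indices do not change, and the new members share one length, so only the total number
has to stay below their common threshold. -/
theorem IsSparse.append {M t n : ℕ} {A A' : List (List Bool)} (hA : IsSparse M t A)
    (hA' : ∀ a ∈ A', a.length = n) (h : A.length + A'.length < 2 ^ (n / M - 2 * t)) :
    IsSparse M t (A ++ A') := by
  intro i hi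
  rw [List.length_append] at hi
  rcases lt_or_ge i A.length with hlt | hge
  · rw [List.getD_append _ _ _ _ hlt]
    exact hA i hlt
  · rw [List.getD_append_right _ _ _ _ hge, List.getD_eq_getElem _ _ (by omega),
      hA' _ (List.getElem_mem _)]
    omega

theorem Meets.mono {ω : BinSeq} {N : ℕ} {A A' : List (List Bool)} (h : Meets ω N A)
    (hA : ∀ a ∈ A, a ∈ A') : Meets ω N A' := by
  obtain ⟨a, ha, h⟩ := h
  exact ⟨a, hA a ha, h⟩

/-- The rate `e` descends from `2 * M + 1`, where there are too few strings of length `2 * M * l`,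
to `0`, where the count condition is automatic. Both `l` and `B` are fixed before `N` and the
family; the next length is chosen so large that a list of size `B` does not harm sparsity. -/
theorem exists_sparse_meeting_of_le_card {M : ℕ} (hM : 0 < M) (t i : ℕ) :
    ∀ e, e + i = 2 * M + 1 → ∀ d, ∃ l B : ℕ, 0 < l ∧ ∀ N, 2 * M * l ≤ N →
      ∀ {ι : Type} (J : Finset ι) (x : ι → BinSeq), ∃ A : List (List Bool),
        IsSparse M t A ∧ A.length ≤ B ∧
        2 ^ d * (J.filter fun j => ¬ Meets (x j) N A ∧
          2 ^ (e * l) ≤ (factors (x j) N (2 * M * l)).card).card ≤ J.card := by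
  classical
  induction i with
  | zero =>
    rintro e he d
    refine ⟨1, 0, one_pos, fun N hN ι J x => ⟨[], by simp [IsSparse], by simp, ?_⟩⟩
    rw [Finset.filter_false_of_mem, Finset.card_empty]
    · simp
    · rintro j - ⟨-, h⟩
      have h2 := h.trans (card_factors_le (x j) N (2 * M * 1))
      rw [Nat.pow_le_pow_iff_right one_lt_two] at h2
      omega
  | succ i ih =>
    intro e he d
    -- The exceptional set will be a union of two, hence `d + 1`.
    obtain ⟨l, B, hl, H⟩ := ih (e + 1) (by omega) (d + 1)
    set C := B + 2 ^ 2 ^ (2 * M * l) * (d + 1) with hC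
    -- This makes `C < 2 ^ (q * l - 2 * t)`, so the constant `C` is absorbed by sparsity.
    set q := 2 * t + C + 1 with hq
    have hql : q ≤ q * l := Nat.le_mul_of_pos_right _ hl
    have hmul : q * (2 * M * l) = 2 * M * (q * l) := by ring
    refine ⟨q * l, B + 2 ^ 2 ^ (2 * M * l) * (2 ^ (q * l) * (d + 1)), by positivity,
      fun N hN ι J x => ?_⟩
    obtain ⟨A, hA1, hA2, hA3⟩ := H N
      ((Nat.mul_le_mul_left _ (Nat.le_mul_of_pos_left l (by omega))).trans hN) J x
    -- The sequences whose rate is at least `e` at the new length but below `e + 1` at the old one: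
    -- their long factors are a `2 ^ (-q * l)` share of the concatenations.
    let K := J.filter fun j => (factors (x j) N (2 * M * l)).card < 2 ^ ((e + 1) * l) ∧
      2 ^ (e * (q * l)) ≤ (factors (x j) N (2 * M * (q * l))).card
    obtain ⟨A', hB1, hB2, hB3⟩ := exists_list_meeting_diverse K x N (2 * M * l) q (q * l) (d + 1)
      (by rwa [hmul]) (fun j hj => by
        obtain ⟨-, h1, h2⟩ := Finset.mem_filter.1 hj
        rw [hmul]
        calc _ ≤ (2 ^ ((e + 1) * l)) ^ q := Nat.pow_le_pow_left h1.le _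
          _ = 2 ^ (q * l) * 2 ^ (e * (q * l)) := by rw [← pow_mul, ← pow_add]; ring_nf
          _ ≤ _ := Nat.mul_le_mul_left _ h2)
    rw [hmul] at hB2
    refine ⟨A ++ A', hA1.append hB2 ?_, ?_, ?_⟩
    -- Strings of length `2 * M * (q * l)` allow `2 ^ (2 * q * l - 2 * t)` indices, while about `2 ^
    -- (q * l)` are used; the factor `2` in `2 * M` provides this room.
    · rw [mul_assoc, Nat.mul_comm 2, mul_assoc, Nat.mul_div_cancel_left _ hM]
      have h1 : A.length + A'.length ≤ 2 ^ (q * l) * C := by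
        calc A.length + A'.length
            ≤ 2 ^ (q * l) * B + 2 ^ 2 ^ (2 * M * l) * (2 ^ (q * l) * (d + 1)) :=
              add_le_add (hA2.trans (Nat.le_mul_of_pos_left _ (by positivity))) hB1
          _ = 2 ^ (q * l) * C := by rw [hC]; ring
      have h2 : C < 2 ^ (q * l - 2 * t) :=
        lt_of_lt_of_le Nat.lt_two_pow_self (Nat.pow_le_pow_right two_pos (by omega))
      calc A.length + A'.length ≤ 2 ^ (q * l) * C := h1
        _ < 2 ^ (q * l) * 2 ^ (q * l - 2 * t) := Nat.mul_lt_mul_of_pos_left h2 (by positivity)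
        _ = _ := by rw [← pow_add]; congr 1; omega
    · rw [List.length_append]
      exact add_le_add hA2 hB1
    · have hsub : (J.filter fun j => ¬ Meets (x j) N (A ++ A') ∧
          2 ^ (e * (q * l)) ≤ (factors (x j) N (2 * M * (q * l))).card) ⊆
          (J.filter fun j => ¬ Meets (x j) N A ∧
            2 ^ ((e + 1) * l) ≤ (factors (x j) N (2 * M * l)).card) ∪
          K.filter fun j => ¬ Meets (x j) N A' := by
        intro j hj
        obtain ⟨hj, h1, h2⟩ := Finset.mem_filter.1 hj
        simp only [K, Finset.mem_union, Finset.mem_filter]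
        rcases lt_or_ge (factors (x j) N (2 * M * l)).card (2 ^ ((e + 1) * l)) with h | h
        · exact Or.inr ⟨⟨hj, h, h2⟩, fun h' => h1 (h'.mono (by simp +contextual))⟩
        · exact Or.inl ⟨hj, fun h' => h1 (h'.mono (by simp +contextual)), h⟩
      have h1 := (Finset.card_le_card hsub).trans (Finset.card_union_le _ _)
      have h2 : K.card ≤ J.card := Finset.card_filter_le _ _
      rw [pow_succ] at hA3 hB3
      have h3 := Nat.mul_le_mul_left (2 ^ d) h1
      rw [mul_add] at h3
      linarith

/-- For all large `N`, every finite family of sequences has a sparse list of strings that meets the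
first `N` places of all but a small part of the family. -/
theorem exists_sparse_meeting {M : ℕ} (hM : 0 < M) (t d : ℕ) :
    ∃ N₀ : ℕ, ∀ N, N₀ ≤ N → ∀ {ι : Type} (J : Finset ι) (x : ι → BinSeq),
      ∃ A : List (List Bool), IsSparse M t A ∧
        2 ^ d * (J.filter fun j => ¬ Meets (x j) N A).card ≤ J.card := by
  obtain ⟨l, B, -, H⟩ := exists_sparse_meeting_of_le_card hM t (2 * M + 1) 0 (by omega) d
  refine ⟨2 * M * l, fun N hN ι J x => ?_⟩
  obtain ⟨A, hA, -, h⟩ := H N hN J x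
  refine ⟨A, hA, ?_⟩
  convert h using 3
  ext j
  simp only [Finset.mem_filter, zero_mul, pow_zero, Nat.one_le_iff_ne_zero, Finset.card_ne_zero]
  have : (factors (x j) N (2 * M * l)).Nonempty := ⟨_, mem_factors.2 ⟨0, by omega, rfl⟩⟩
  tauto

/-! ### Finite approximations of oracle computations -/

theorem substring_zero_prefix (ω : BinSeq) {k l : ℕ} (h : k ≤ l) :
    substring ω 0 k <+: substring ω 0 l := by
  obtain ⟨m, rfl⟩ := Nat.exists_eq_add_of_le h
  rw [substring_add]
  exact List.prefix_append _ _

/-- `g σ n` is a value that a computation on `n` yields in `|σ|` steps from the finite part `σ` of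
the oracle, and `f` is the result of this computation for the oracle `ω`. -/
structure Approximates (ω : BinSeq) (g : List Bool → ℕ → Option ℕ) (f : ℕ →. ℕ) : Prop where
  primrec : Primrec₂ g
  mono : ∀ {σ σ' : List Bool} {n y : ℕ}, σ <+: σ' → g σ n = some y → g σ' n = some y
  complete : ∀ {n y : ℕ}, y ∈ f n → ∃ k, g (substring ω 0 k) n = some y

theorem Approximates.mono_substring {ω : BinSeq} {g : List Bool → ℕ → Option ℕ} {f : ℕ →. ℕ}
    (h : Approximates ω g f) {k l n y : ℕ} (hkl : k ≤ l) (hy : g (substring ω 0 k) n = some y) :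
    g (substring ω 0 l) n = some y :=
  h.mono (substring_zero_prefix ω hkl) hy

theorem Approximates.of_primrec (ω : BinSeq) {f : ℕ → ℕ} (hf : Primrec f) :
    Approximates ω (fun _ n => some (f n)) fun n => Part.some (f n) where
  primrec := (Primrec.option_some.comp (hf.comp Primrec.snd)).to₂
  mono _ h := h
  complete h := ⟨0, by rw [Part.mem_some_iff.1 h]⟩

theorem Approximates.oracle (ω : BinSeq) :
    Approximates ω (fun σ n => σ[n]?.map Bool.toNat) (toOracle ω) where
  primrec := Primrec.option_map (Primrec.list_getElem?)
    ((Primrec.dom_bool _).comp Primrec.snd).to₂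
  mono := by
    rintro σ _ n y ⟨τ, rfl⟩ h
    simp only [Option.map_eq_some_iff] at h ⊢
    obtain ⟨b, hb, rfl⟩ := h
    obtain ⟨hlt, -⟩ := List.getElem?_eq_some_iff.1 hb
    exact ⟨b, by rw [List.getElem?_append_left hlt, hb], rfl⟩
  complete := by
    intro n y h
    refine ⟨n + 1, ?_⟩
    rw [Part.mem_some_iff.1 h]
    simp [substring]

theorem Approximates.pair {ω : BinSeq} {g₁ g₂ : List Bool → ℕ → Option ℕ} {f₁ f₂ : ℕ →. ℕ}
    (h₁ : Approximates ω g₁ f₁) (h₂ : Approximates ω g₂ f₂) :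
    Approximates ω (fun σ n => (g₁ σ n).bind fun u => (g₂ σ n).map fun v => Nat.pair u v)
      fun n => Nat.pair <$> f₁ n <*> f₂ n where
  primrec := Primrec.option_bind h₁.primrec
    (Primrec.option_map (h₂.primrec.comp (Primrec.fst.comp Primrec.fst)
      (Primrec.snd.comp Primrec.fst))
      (Primrec₂.natPair.comp (Primrec.snd.comp Primrec.fst) Primrec.snd).to₂).to₂
  mono := by
    intro σ σ' n y hσ h
    simp only [Option.bind_eq_some_iff, Option.map_eq_some_iff] at h ⊢
    obtain ⟨u, hu, v, hv, rfl⟩ := h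
    exact ⟨u, h₁.mono hσ hu, v, h₂.mono hσ hv, rfl⟩
  complete := by
    intro n y h
    simp only [Seq.seq, Part.map_eq_map, Part.bind_map, Part.mem_bind_iff, Part.mem_map_iff] at h
    obtain ⟨u, hu, v, hv, rfl⟩ := h
    obtain ⟨k, hk⟩ := h₁.complete hu
    obtain ⟨l, hl⟩ := h₂.complete hv
    refine ⟨max k l, ?_⟩
    rw [h₁.mono_substring (le_max_left k l) hk, h₂.mono_substring (le_max_right k l) hl]
    rfl

theorem Approximates.comp {ω : BinSeq} {g₁ g₂ : List Bool → ℕ → Option ℕ} {f₁ f₂ : ℕ →. ℕ}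
    (h₁ : Approximates ω g₁ f₁) (h₂ : Approximates ω g₂ f₂) :
    Approximates ω (fun σ n => (g₂ σ n).bind fun u => g₁ σ u) fun n => f₂ n >>= f₁ where
  primrec := Primrec.option_bind h₂.primrec
    (h₁.primrec.comp (Primrec.fst.comp Primrec.fst) Primrec.snd).to₂
  mono := by
    intro σ σ' n y hσ h
    simp only [Option.bind_eq_some_iff] at h ⊢
    obtain ⟨u, hu, hy⟩ := h
    exact ⟨u, h₂.mono hσ hu, h₁.mono hσ hy⟩
  complete := by
    intro n y h
    obtain ⟨u, hu, hy⟩ := Part.mem_bind_iff.1 h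
    obtain ⟨k, hk⟩ := h₂.complete hu
    obtain ⟨l, hl⟩ := h₁.complete hy
    refine ⟨max k l, ?_⟩
    rw [h₂.mono_substring (le_max_left k l) hk]
    exact h₁.mono_substring (le_max_right k l) hl

theorem Approximates.prec {ω : BinSeq} {g₁ g₂ : List Bool → ℕ → Option ℕ} {f₁ f₂ : ℕ →. ℕ}
    (h₁ : Approximates ω g₁ f₁) (h₂ : Approximates ω g₂ f₂) :
    Approximates ω
      (fun σ p => Nat.rec (g₁ σ p.unpair.1)
        (fun m ih => ih.bind fun i => g₂ σ (Nat.pair p.unpair.1 (Nat.pair m i))) p.unpair.2)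
      fun p => Nat.rec (f₁ p.unpair.1)
        (fun m ih => ih >>= fun i => f₂ (Nat.pair p.unpair.1 (Nat.pair m i))) p.unpair.2 where
  primrec := by
    refine Primrec.nat_rec' (f := fun q : List Bool × ℕ => q.2.unpair.2)
      (g := fun q : List Bool × ℕ => g₁ q.1 q.2.unpair.1)
      (h := fun (q : List Bool × ℕ) (r : ℕ × Option ℕ) =>
        r.2.bind fun i => g₂ q.1 (Nat.pair q.2.unpair.1 (Nat.pair r.1 i)))
      (Primrec.snd.comp (Primrec.unpair.comp Primrec.snd))
      (h₁.primrec.comp Primrec.fst (Primrec.fst.comp (Primrec.unpair.comp Primrec.snd))) ?_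
    refine Primrec.option_bind (Primrec.snd.comp Primrec.snd) ?_
    refine h₂.primrec.comp (Primrec.fst.comp (Primrec.fst.comp Primrec.fst)) ?_
    refine Primrec₂.natPair.comp (Primrec.fst.comp (Primrec.unpair.comp
      (Primrec.snd.comp (Primrec.fst.comp Primrec.fst)))) ?_
    exact Primrec₂.natPair.comp (Primrec.fst.comp (Primrec.snd.comp Primrec.fst)) Primrec.snd
  mono := by
    intro σ σ' p y hσ
    induction p.unpair.2 generalizing y with
    | zero => exact h₁.mono hσ
    | succ m ih =>
      intro h
      simp only [Option.bind_eq_some_iff] at h ⊢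
      obtain ⟨u, hu, hy⟩ := h
      exact ⟨u, ih hu, h₂.mono hσ hy⟩
  complete := by
    -- Stated for all `l ≥ k`, so that the recursive value and the next step can be evaluated on a
    -- common prefix.
    have main : ∀ a m y : ℕ, y ∈ (Nat.rec (f₁ a)
        (fun m ih => ih >>= fun i => f₂ (Nat.pair a (Nat.pair m i))) m : Part ℕ) →
        ∃ k, ∀ l, k ≤ l → (Nat.rec (g₁ (substring ω 0 l) a)
          (fun m ih => ih.bind fun i => g₂ (substring ω 0 l) (Nat.pair a (Nat.pair m i))) m :
            Option ℕ) = some y := by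
      intro a m
      induction m with
      | zero =>
        intro y h
        obtain ⟨k, hk⟩ := h₁.complete h
        exact ⟨k, fun l hl => h₁.mono_substring hl hk⟩
      | succ m ih =>
        intro y h
        simp only [Part.bind_eq_bind, Part.mem_bind_iff] at h
        obtain ⟨u, hu, hy⟩ := h
        obtain ⟨k, hk⟩ := ih u hu
        obtain ⟨k', hk'⟩ := h₂.complete hy
        refine ⟨max k k', fun l hl => ?_⟩
        simp only [Option.bind_eq_some_iff]
        exact ⟨u, hk l ((le_max_left _ _).trans hl),
          h₂.mono_substring ((le_max_right _ _).trans hl) hk'⟩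
    intro p y h
    obtain ⟨k, hk⟩ := main _ _ y h
    exact ⟨k, hk k le_rfl⟩

/-- The index below `b` at which `u` vanishes for the first time, if `u` is defined up to there. -/
def boundedRfind (u : ℕ → Option ℕ) (b : ℕ) : Option ℕ :=
  let i := (List.range b).findIdx fun n => (u n).getD 0 == 0
  if u i = some 0 ∧ i < b then some i else none

/-- `getD 0` makes an undefined value stop the search just as a zero does, and the test `u i = some
0` then rejects it. Hence success requires all earlier values to be defined, which makes the search
monotone. -/
theorem boundedRfind_eq_some {u : ℕ → Option ℕ} {b i : ℕ} :
    boundedRfind u b = some i ↔ i < b ∧ u i = some 0 ∧ ∀ j < i, ∃ v, v ≠ 0 ∧ u j = some v := by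
  have key : ∀ j, ((u j).getD 0 == 0) = false ↔ ∃ v, v ≠ 0 ∧ u j = some v := by
    intro j
    cases h : u j with
    | none => simp
    | some v => simp
  have hidx : ∀ i < b, ((List.range b).findIdx fun n => (u n).getD 0 == 0) = i ↔
      ((u i).getD 0 == 0) = true ∧ ∀ j < i, ((u j).getD 0 == 0) = false := by
    intro i hi
    rw [List.findIdx_eq (by simpa using hi)]
    simp
  simp only [boundedRfind, Option.ite_none_right_eq_some, Option.some.injEq]
  constructor
  · rintro ⟨⟨h0, hlt⟩, rfl⟩
    exact ⟨hlt, h0, fun j hj => (key j).1 (((hidx _ hlt).1 rfl).2 j hj)⟩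
  · rintro ⟨hlt, h0, hmin⟩
    have := (hidx i hlt).2 ⟨by simp [h0], fun j hj => (key j).2 (hmin j hj)⟩
    rw [this]
    exact ⟨⟨h0, hlt⟩, rfl⟩

theorem Approximates.rfind {ω : BinSeq} {g : List Bool → ℕ → Option ℕ} {f : ℕ →. ℕ}
    (h : Approximates ω g f) :
    Approximates ω (fun σ a => boundedRfind (fun n => g σ (Nat.pair a n)) σ.length)
      fun a => Nat.rfind fun n => (fun m => m = 0) <$> f (Nat.pair a n) where
  primrec := by
    have hg : Primrec₂ fun (q : List Bool × ℕ) (n : ℕ) => g q.1 (Nat.pair q.2 n) :=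
      (h.primrec.comp (Primrec.fst.comp Primrec.fst)
        (Primrec₂.natPair.comp (Primrec.snd.comp Primrec.fst) Primrec.snd)).to₂
    have hlen : Primrec fun q : List Bool × ℕ => q.1.length :=
      Primrec.list_length.comp Primrec.fst
    have hi : Primrec fun q : List Bool × ℕ =>
        (List.range q.1.length).findIdx fun n => (g q.1 (Nat.pair q.2 n)).getD 0 == 0 :=
      Primrec.list_findIdx (Primrec.list_range.comp hlen)
        (Primrec.beq.comp (Primrec.option_getD.comp hg (Primrec.const 0)) (Primrec.const 0)).to₂
    exact Primrec.ite ((Primrec.eq.comp (hg.comp Primrec.id hi) (Primrec.const (some 0))).and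
      (Primrec.nat_lt.comp hi hlen)) (Primrec.option_some.comp hi) (Primrec.const none)
  mono := by
    intro σ σ' a y hσ hy
    rw [boundedRfind_eq_some] at hy ⊢
    obtain ⟨h1, h2, h3⟩ := hy
    refine ⟨h1.trans_le hσ.length_le, h.mono hσ h2, fun j hj => ?_⟩
    obtain ⟨v, hv, hv'⟩ := h3 j hj
    exact ⟨v, hv, h.mono hσ hv'⟩
  complete := by
    intro a y hy
    obtain ⟨h1, h2⟩ := Nat.mem_rfind.1 hy
    obtain ⟨v, hv, hv0⟩ := (Part.mem_map_iff _).1 h1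
    obtain rfl : v = 0 := by simpa using hv0
    have h3 : ∀ j, ∃ k, j < y → ∃ v, v ≠ 0 ∧ g (substring ω 0 k) (Nat.pair a j) = some v := by
      intro j
      by_cases hj : j < y
      · obtain ⟨v, hv, hv'⟩ := (Part.mem_map_iff _).1 (h2 hj)
        obtain ⟨k, hk⟩ := h.complete hv
        exact ⟨k, fun _ => ⟨v, by simpa using hv', hk⟩⟩
      · exact ⟨0, fun h => absurd h hj⟩
    choose k hk using h3
    obtain ⟨k₀, hk₀⟩ := h.complete hv
    refine ⟨max (max k₀ (y + 1)) ((Finset.range y).sup k), ?_⟩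
    rw [boundedRfind_eq_some, length_substring]
    refine ⟨by omega, h.mono_substring (by omega) hk₀, fun j hj => ?_⟩
    obtain ⟨v, hv, hv'⟩ := hk j hj
    have := Finset.le_sup (f := k) (Finset.mem_range.2 hj)
    exact ⟨v, hv, h.mono_substring (by omega) hv'⟩

/-- No soundness of `g` is needed: where `f` is defined, completeness and monotonicity leave `g` no
other value along `ω`. -/
theorem exists_approximates {ω : BinSeq} {f : ℕ →. ℕ}
    (hf : Nat.RecursiveIn {toOracle ω} f) : ∃ g, Approximates ω g f := by
  induction hf with
  | zero => exact ⟨_, Approximates.of_primrec ω (Primrec.const 0)⟩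
  | succ => exact ⟨_, Approximates.of_primrec ω Primrec.succ⟩
  | left => exact ⟨_, Approximates.of_primrec ω (Primrec.fst.comp Primrec.unpair)⟩
  | right => exact ⟨_, Approximates.of_primrec ω (Primrec.snd.comp Primrec.unpair)⟩
  | oracle g hg =>
    obtain rfl : g = toOracle ω := hg
    exact ⟨_, Approximates.oracle ω⟩
  | pair _ _ h₁ h₂ =>
    obtain ⟨g₁, h₁⟩ := h₁
    obtain ⟨g₂, h₂⟩ := h₂
    exact ⟨_, h₁.pair h₂⟩
  | comp _ _ h₁ h₂ =>
    obtain ⟨g₁, h₁⟩ := h₁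
    obtain ⟨g₂, h₂⟩ := h₂
    exact ⟨_, h₁.comp h₂⟩
  | prec _ _ h₁ h₂ =>
    obtain ⟨g₁, h₁⟩ := h₁
    obtain ⟨g₂, h₂⟩ := h₂
    exact ⟨_, h₁.prec h₂⟩
  | rfind _ h =>
    obtain ⟨g, h⟩ := h
    exact ⟨_, h.rfind⟩

/-! ### Functionals from finite oracles to output prefixes -/

/-- A monotone functional on finite strings: `G σ N` is the prefix of length `N` of the output
sequence, if the part `σ` of the oracle suffices to find it in `|σ|` steps. -/
structure IsFunctional (G : List Bool → ℕ → Option (List Bool)) : Prop where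
  primrec : Primrec₂ G
  mono : ∀ {σ σ' : List Bool} {N : ℕ} {x : List Bool}, σ <+: σ' → G σ N = some x → G σ' N = some x
  length_eq : ∀ {σ : List Bool} {N : ℕ} {x : List Bool}, G σ N = some x → x.length = N
  isSome_of_le : ∀ {σ : List Bool} {N N' : ℕ}, N ≤ N' → (G σ N').isSome → (G σ N).isSome

/-- The prefix of length `N` of the output of an approximation. -/
def outputPrefix (g : List Bool → ℕ → Option ℕ) (σ : List Bool) (N : ℕ) : Option (List Bool) :=
  Nat.rec (some []) (fun n ih => ih.bind fun x =>
    ((g σ n).bind (Encodable.decode (α := Bool))).map fun b => x ++ [b]) N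

theorem Approximates.isFunctional {ω : BinSeq} {g : List Bool → ℕ → Option ℕ} {f : ℕ →. ℕ}
    (h : Approximates ω g f) : IsFunctional (outputPrefix g) where
  primrec := by
    refine Primrec.nat_rec' (f := fun q : List Bool × ℕ => q.2)
      (g := fun q : List Bool × ℕ => some [])
      (h := fun (q : List Bool × ℕ) (r : ℕ × Option (List Bool)) =>
        r.2.bind fun x => ((g q.1 r.1).bind (Encodable.decode (α := Bool))).map
          fun b => x ++ [b]) Primrec.snd (Primrec.const _) ?_
    refine Primrec.option_bind (Primrec.snd.comp Primrec.snd) ?_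
    refine Primrec.option_map (Primrec.option_bind (h.primrec.comp
      (Primrec.fst.comp (Primrec.fst.comp Primrec.fst))
      (Primrec.fst.comp (Primrec.snd.comp Primrec.fst))) (Primrec.decode.comp Primrec.snd).to₂) ?_
    exact (Primrec.list_append.comp (Primrec.snd.comp Primrec.fst)
      (Primrec.list_cons.comp Primrec.snd (Primrec.const []))).to₂
  mono := by
    intro σ σ' N x hσ
    induction N generalizing x with
    | zero => exact id
    | succ n ih =>
      intro hx
      simp only [outputPrefix, Option.bind_eq_some_iff, Option.map_eq_some_iff] at hx ⊢
      obtain ⟨y, hy, b, ⟨v, hv, hb⟩, rfl⟩ := hx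
      exact ⟨y, ih hy, b, ⟨v, h.mono hσ hv, hb⟩, rfl⟩
  length_eq := by
    intro σ N x
    induction N generalizing x with
    | zero =>
      intro hx
      obtain rfl : [] = x := Option.some.inj hx
      rfl
    | succ n ih =>
      intro hx
      simp only [outputPrefix, Option.bind_eq_some_iff, Option.map_eq_some_iff] at hx
      obtain ⟨y, hy, b, -, rfl⟩ := hx
      simp [ih hy]
  isSome_of_le := by
    intro σ N N' hN
    induction hN with
    | refl => exact id
    | step _ ih =>
      intro hs
      refine ih ?_
      obtain ⟨x, hx⟩ := Option.isSome_iff_exists.1 hs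
      simp only [outputPrefix, Option.bind_eq_some_iff] at hx
      obtain ⟨y, hy, -⟩ := hx
      exact Option.isSome_iff_exists.2 ⟨y, hy⟩

/-- Every sequence that is computable from `ω` is the output of a functional. -/
theorem exists_functional {ω τ : BinSeq} (h : ComputableIn {toOracle ω} τ) :
    ∃ G, IsFunctional G ∧ ∀ N, ∃ k, G (substring ω 0 k) N = some (substring τ 0 N) := by
  obtain ⟨g, hg⟩ := exists_approximates h
  refine ⟨outputPrefix g, hg.isFunctional, fun N => ?_⟩
  induction N with
  | zero => exact ⟨0, rfl⟩
  | succ n ih =>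
    obtain ⟨k, hk⟩ := ih
    obtain ⟨l, hl⟩ := hg.complete (n := n) (y := Encodable.encode (τ n)) (by simp)
    refine ⟨max k l, ?_⟩
    have h1 := hg.isFunctional.mono (substring_zero_prefix ω (le_max_left k l)) hk
    have h2 := hg.mono_substring (le_max_right k l) hl
    change ((outputPrefix g (substring ω 0 (max k l)) n).bind fun x => _) = _
    rw [h1]
    have h3 : substring τ 0 (n + 1) = substring τ 0 n ++ [τ n] := by
      simp [substring, List.range_succ]
    simp [h2, h3]

/-! ### Countability -/

/-- A code determines its function, and codes are countable. -/
theorem countable_setOf_partrec (α σ : Type*) [Primcodable α] [Primcodable σ] :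
    {f : α →. σ | Partrec f}.Countable := by
  have hinj : Function.Injective fun f : {f : α →. σ // Partrec f} =>
      (Nat.Partrec.Code.exists_code.1 f.2).choose := by
    intro f f' h
    have h1 := (Nat.Partrec.Code.exists_code.1 f.2).choose_spec
    have h2 := (Nat.Partrec.Code.exists_code.1 f'.2).choose_spec
    dsimp only at h
    rw [h, h2] at h1
    ext a b
    have h3 := congrFun h1 (Encodable.encode a)
    simp only [Encodable.encodek, Part.coe_some, Part.bind_some] at h3
    have h4 := congrArg (fun p => Encodable.encode b ∈ p) h3
    simpa using h4.symm
  exact Set.countable_coe_iff.1 hinj.countable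

theorem countable_setOf_isFunctional : {G | IsFunctional G}.Countable := by
  let toPart : (List Bool → ℕ → Option (List Bool)) →
      (List Bool × ℕ →. Option (List Bool)) := fun G p => Part.some (G p.1 p.2)
  have hinj : Function.Injective toPart := by
    intro G G' h
    funext σ N
    exact Part.some_injective (congrFun h (σ, N))
  refine ((countable_setOf_partrec _ _).preimage hinj).mono fun G hG => ?_
  exact hG.primrec.to_comp.partrec

theorem countable_setOf_isMartinLofTest : {W | IsMartinLofTest W}.Countable := by
  let toPart : (ℕ → Set (List Bool)) → (ℕ × List Bool →. Unit) :=
    fun W p => Part.assert (p.2 ∈ W p.1) fun _ => Part.some ()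
  have hinj : Function.Injective toPart := by
    intro W W' h
    funext n
    ext s
    have h1 := congrArg (fun p => () ∈ p) (congrFun h (n, s))
    simpa [toPart, Part.mem_assert_iff] using h1
  refine ((countable_setOf_partrec _ _).preimage hinj).mono fun W hW => ?_
  exact hW.re

/-! ### Complexity of the members of computable lists -/

/-- The number with the given binary digits, the least significant digit first. -/
def binaryValue (p : List Bool) : ℕ :=
  p.foldr (fun b n => bif b then 2 * n + 1 else 2 * n) 0

theorem primrec_binaryValue : Primrec binaryValue :=
  Primrec.list_foldr Primrec.id (Primrec.const 0)
    (Primrec.cond (Primrec.fst.comp Primrec.snd)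
      (Primrec.nat_double_succ.comp (Primrec.snd.comp Primrec.snd))
      (Primrec.nat_double.comp (Primrec.snd.comp Primrec.snd))).to₂

theorem exists_binaryValue_eq (k i : ℕ) (h : i < 2 ^ k) :
    ∃ p : List Bool, p.length = k ∧ binaryValue p = i := by
  induction k generalizing i with
  | zero => exact ⟨[], rfl, by simp [binaryValue]; omega⟩
  | succ k ih =>
    obtain ⟨p, hp, hpi⟩ := ih (i / 2) (by rw [pow_succ] at h; omega)
    refine ⟨(i % 2 == 1) :: p, by simp [hp], ?_⟩
    change (bif i % 2 == 1 then 2 * binaryValue p + 1 else 2 * binaryValue p) = i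
    rw [hpi]
    rcases Nat.mod_two_eq_zero_or_one i with h0 | h0 <;> simp [h0] <;> omega

/-- The members of a computable sequence of lists have short descriptions. -/
theorem IsOptimal.exists_complexity_le {U : List Bool →. List Bool} (hU : IsOptimal U)
    {f : ℕ → List (List Bool)} (hf : Computable f) :
    ∃ c : ℕ, ∀ t i k : ℕ, ∀ x : List Bool, (f t)[i]? = some x → i < 2 ^ k →
      complexity U x ≤ t + k + c := by
  let rest : List Bool → List Bool := fun p => List.tail^[p.findIdx id + 1] p
  have hidx : Primrec fun p : List Bool => p.findIdx id :=
    Primrec.list_findIdx Primrec.id (Primrec.snd.to₂)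
  have hrest : Primrec rest :=
    Primrec.nat_iterate (Primrec.succ.comp hidx) Primrec.id
      (Primrec.list_tail.comp Primrec.snd).to₂
  -- The program `0 ^ t 1 p`, with `p` the `k` binary digits of the index, has length `t + k + 1`;
  -- hence the constant `c + 1` below.
  have hV : Partrec fun p : List Bool =>
      (((f (p.findIdx id))[binaryValue (rest p)]? : Option (List Bool)) : Part (List Bool)) :=
    (Computable.list_getElem?.comp (hf.comp hidx.to_comp)
      (primrec_binaryValue.comp hrest).to_comp).ofOption
  obtain ⟨c, hc⟩ := hU.2 _ hV
  have h1 : ∀ (e : ℕ) (p : List Bool), (List.replicate e false ++ true :: p).findIdx id = e := by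
    intro e p
    induction e with
    | zero => simp [List.findIdx_cons]
    | succ e ih => simp [List.replicate_succ, List.findIdx_cons, ih]
  have h2 : ∀ (e : ℕ) (p : List Bool),
      List.tail^[e + 1] (List.replicate e false ++ true :: p) = p := by
    intro e p
    induction e with
    | zero => simp
    | succ e ih => rw [Function.iterate_succ_apply]; simpa [List.replicate_succ] using ih
  refine ⟨c + 1, fun t i k x hx hi => ?_⟩
  obtain ⟨p, rfl, rfl⟩ := exists_binaryValue_eq k i hi
  obtain ⟨q, hq, hlen⟩ := hc (List.replicate t false ++ true :: p) x (by
    simp only [rest, h1, h2]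
    simp [hx])
  refine le_trans (Nat.sInf_le ⟨q, hq, rfl⟩) (hlen.trans ?_)
  simp
  omega

/-- A computable choice of witnesses for a decidable relation. -/
theorem exists_computable_choice {β : Type*} [Primcodable β] {R : ℕ → β → Prop}
    (hR : PrimrecRel R) (h : ∀ t, ∃ b, R t b) :
    ∃ f : ℕ → β, Computable f ∧ ∀ t, R t (f t) := by
  classical
  let g : ℕ → ℕ → Option β := fun t n =>
    (Encodable.decode (α := β) n).bind fun b => if R t b then some b else none
  have hg : Primrec₂ g := by
    refine Primrec.option_bind (Primrec.decode.comp Primrec.snd) ?_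
    exact Primrec.ite (hR.comp (Primrec.fst.comp Primrec.fst) Primrec.snd)
      (Primrec.option_some.comp Primrec.snd) (Primrec.const none)
  have hg' : ∀ {t n b}, b ∈ g t n → R t b := by
    intro t n b hb
    simp only [g, Option.mem_def, Option.bind_eq_some_iff, Option.ite_none_right_eq_some,
      Option.some.injEq] at hb
    obtain ⟨_, -, hb, rfl⟩ := hb
    exact hb
  have hdom : ∀ t, (Nat.rfindOpt (g t)).Dom := by
    intro t
    obtain ⟨b, hb⟩ := h t
    exact Nat.rfindOpt_dom.2 ⟨Encodable.encode b, b, by simp [g, hb]⟩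
  refine ⟨fun t => (Nat.rfindOpt (g t)).get (hdom t),
    Partrec.of_eq_tot (Partrec.rfindOpt hg.to_comp) fun t => Part.get_mem _, fun t => ?_⟩
  obtain ⟨n, hn⟩ := Nat.rfindOpt_spec (Part.get_mem (hdom t))
  exact hg' hn

/-! ### The search for sparse lists that meet most outputs of a functional -/

/-- Some member of the list `A` occurs in the string `x`. -/
def MeetsString (x : List Bool) (A : List (List Bool)) : Prop :=
  ∃ a ∈ A, ∃ k < x.length + 1, (x.drop k).take a.length = a

instance : DecidableRel MeetsString := fun x A =>
  inferInstanceAs (Decidable (∃ a ∈ A, ∃ k < x.length + 1, (x.drop k).take a.length = a))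

theorem take_drop_substring (ω : BinSeq) {N k n : ℕ} (h : k + n ≤ N) :
    ((substring ω 0 N).drop k).take n = substring ω k n := by
  obtain ⟨m, rfl⟩ := Nat.exists_eq_add_of_le h
  rw [add_assoc, substring_add, List.drop_left' (length_substring _ _ _), substring_add,
    List.take_left' (length_substring _ _ _), zero_add]

theorem meetsString_substring_iff {ω : BinSeq} {N : ℕ} {A : List (List Bool)} :
    MeetsString (substring ω 0 N) A ↔ Meets ω N A := by
  refine exists_congr fun a => and_congr_right fun _ => ?_
  rw [mem_factors, length_substring]
  refine exists_congr fun k => ⟨?_, ?_⟩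
  · rintro ⟨hk, h⟩
    -- A truncated `take` would be shorter than `a`, so the occurrence lies within the first `N`
    -- places.
    have hlen := congrArg List.length h
    rw [List.length_take, List.length_drop, length_substring] at hlen
    have hkN : k + a.length ≤ N := by omega
    exact ⟨hkN, by rwa [take_drop_substring ω hkN] at h⟩
  · rintro ⟨hk, h⟩
    exact ⟨by omega, by rwa [take_drop_substring ω hk]⟩

theorem primrecRel_meetsString : PrimrecRel MeetsString := by
  have h1 : PrimrecRel fun (k : ℕ) (q : List Bool × List Bool) =>
      (q.1.drop k).take q.2.length = q.2 :=
    Primrec.eq.comp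
      (Primrec.list_take.comp (Primrec.list_length.comp (Primrec.snd.comp Primrec.snd))
        (Primrec.list_drop.comp Primrec.fst (Primrec.fst.comp Primrec.snd)))
      (Primrec.snd.comp Primrec.snd)
  have h2 : PrimrecRel fun (a x : List Bool) =>
      ∃ k ∈ List.range (x.length + 1), (x.drop k).take a.length = a :=
    PrimrecRel.comp (f := fun q : List Bool × List Bool => List.range (q.2.length + 1))
      (g := fun q : List Bool × List Bool => (q.2, q.1)) h1.exists_mem_list
      (Primrec.list_range.comp (Primrec.succ.comp (Primrec.list_length.comp Primrec.snd)))
      (Primrec.pair Primrec.snd Primrec.fst)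
  refine h2.exists_mem_list.swap.of_eq fun x A => ?_
  simp only [Function.swap, List.mem_range, MeetsString]

theorem primrec_nat_pow : Primrec₂ ((· ^ ·) : ℕ → ℕ → ℕ) :=
  Primrec₂.unpaired'.1 Nat.Primrec.pow

theorem primrecRel_isSparse (M : ℕ) : PrimrecRel (IsSparse M) := by
  have h : PrimrecRel fun (i : ℕ) (q : ℕ × List (List Bool)) =>
      i + 1 < 2 ^ ((q.2.getD i []).length / M - 2 * q.1) := by
    refine Primrec.nat_lt.comp (Primrec.succ.comp Primrec.fst)
      (primrec_nat_pow.comp (Primrec.const 2) (Primrec.nat_sub.comp (Primrec.nat_div.comp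
        (Primrec.list_length.comp ?_) (Primrec.const M)) (Primrec.nat_double.comp ?_)))
    · exact (Primrec.list_getD []).comp (Primrec.snd.comp Primrec.snd) Primrec.fst
    · exact Primrec.fst.comp Primrec.snd
  refine (PrimrecRel.comp (f := fun q : ℕ × List (List Bool) => List.range q.2.length)
    (g := fun q => q) h.forall_mem_list
    (Primrec.list_range.comp (Primrec.list_length.comp Primrec.snd)) Primrec.id).of_eq fun q => ?_
  simp only [List.mem_range, IsSparse]

theorem primrec_strings : Primrec strings := by
  have h : Primrec fun n : ℕ => (Nat.rec [[]] (fun _ ih => ih.flatMap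
      fun l : List Bool => [false :: l, true :: l]) n : List (List Bool)) := by
    refine Primrec.nat_rec₁ _ ?_
    refine Primrec.list_flatMap Primrec.snd ?_
    refine Primrec.list_cons.comp (Primrec.list_cons.comp (Primrec.const false) Primrec.snd) ?_
    exact Primrec.list_cons.comp (Primrec.list_cons.comp (Primrec.const true) Primrec.snd)
      (Primrec.const [])
  refine h.of_eq fun n => ?_
  induction n with
  | zero => rfl
  | succ n ih => rw [strings, ← ih]

/-- The outputs of length `N` that arise from strings of length `s`, with multiplicity. -/
def outputs (G : List Bool → ℕ → Option (List Bool)) (N s : ℕ) : List (List Bool) :=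
  (strings s).filterMap fun σ => G σ N

theorem IsFunctional.primrec_outputs {G : List Bool → ℕ → Option (List Bool)}
    (hG : IsFunctional G) : Primrec₂ (outputs G) :=
  Primrec.listFilterMap (primrec_strings.comp Primrec.snd)
    (hG.primrec.comp Primrec.snd (Primrec.fst.comp Primrec.fst)).to₂

/-- In the triple `w = (N, s, A)`, the strings of length `s` that yield an output of length `N` have
proportion at least `a / b`, and `A` is a sparse list of strings that meets these outputs up to a
proportion of at most `2⁻ᵈ` of the strings of length `s`. -/
def IsWitness (G : List Bool → ℕ → Option (List Bool)) (a b d M t : ℕ)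
    (w : ℕ × ℕ × List (List Bool)) : Prop :=
  (t ≤ w.1 ∧ a * 2 ^ w.2.1 ≤ b * (outputs G w.1 w.2.1).length) ∧ IsSparse M t w.2.2 ∧
    2 ^ d * ((outputs G w.1 w.2.1).filter fun x => ¬ MeetsString x w.2.2).length ≤ 2 ^ w.2.1

theorem IsFunctional.primrecRel_isWitness {G : List Bool → ℕ → Option (List Bool)}
    (hG : IsFunctional G) (a b d M : ℕ) : PrimrecRel (IsWitness G a b d M) := by
  have hN : Primrec fun q : ℕ × ℕ × ℕ × List (List Bool) => q.2.1 :=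
    Primrec.fst.comp Primrec.snd
  have hs : Primrec fun q : ℕ × ℕ × ℕ × List (List Bool) => q.2.2.1 :=
    Primrec.fst.comp (Primrec.snd.comp Primrec.snd)
  have hA : Primrec fun q : ℕ × ℕ × ℕ × List (List Bool) => q.2.2.2 :=
    Primrec.snd.comp (Primrec.snd.comp Primrec.snd)
  have hpow := primrec_nat_pow.comp (Primrec.const 2) hs
  have hout := hG.primrec_outputs.comp hN hs
  have hfilter : Primrec₂ fun (L A : List (List Bool)) =>
      L.filter fun x => ¬ MeetsString x A := primrecRel_meetsString.not.listFilter
  refine ((Primrec.nat_le.comp Primrec.fst hN).and (Primrec.nat_le.comp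
    (Primrec.nat_mul.comp (Primrec.const a) hpow)
    (Primrec.nat_mul.comp (Primrec.const b) (Primrec.list_length.comp hout)))).and
    (((primrecRel_isSparse M).comp Primrec.fst hA).and (Primrec.nat_le.comp
      (Primrec.nat_mul.comp (Primrec.const (2 ^ d))
        (Primrec.list_length.comp (hfilter.comp hout hA))) hpow))

theorem length_outputs (G : List Bool → ℕ → Option (List Bool)) (N s : ℕ) :
    (outputs G N s).length = (strings s).countP fun σ => (G σ N).isSome := by
  simp [outputs, List.length_filterMap_eq_countP]

theorem length_filter_outputs (G : List Bool → ℕ → Option (List Bool)) (N s : ℕ)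
    (A : List (List Bool)) :
    ((outputs G N s).filter fun x => ¬ MeetsString x A).length =
      (strings s).countP fun σ => (G σ N).any fun x => ¬ MeetsString x A := by
  rw [← List.countP_eq_length_filter, outputs, List.countP_filterMap]
  congr 1
  funext σ
  cases G σ N <;> rfl

theorem countP_strings (s : ℕ) (P : List Bool → Bool) :
    (strings s).countP P = ((strings s).toFinset.filter fun σ => P σ).card := by
  rw [List.countP_eq_length_filter, ← List.toFinset_card_of_nodup ((nodup_strings s).filter _),
    List.toFinset_filter]

/-- Sparse lists that meet most outputs of a functional. -/
theorem IsFunctional.exists_sparse_meeting {G : List Bool → ℕ → Option (List Bool)}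
    (hG : IsFunctional G) {M : ℕ} (hM : 0 < M) (t d : ℕ) :
    ∃ N₀ : ℕ, ∀ N, N₀ ≤ N → ∀ s, ∃ A : List (List Bool), IsSparse M t A ∧
      2 ^ d * ((outputs G N s).filter fun x => ¬ MeetsString x A).length ≤ 2 ^ s := by
  obtain ⟨N₀, H⟩ := KolmogorovRandom.exists_sparse_meeting hM t d
  refine ⟨N₀, fun N hN s => ?_⟩
  -- Finite outputs are padded with `false`; only their first `N` places matter. Indexing by `σ`
  -- counts outputs with multiplicity.
  let x : List Bool → BinSeq := fun σ i => ((G σ N).getD []).getD i false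
  have hx : ∀ {σ y}, G σ N = some y → substring (x σ) 0 N = y := by
    intro σ y h
    have hlen := hG.length_eq h
    refine List.ext_getElem (by rw [length_substring, hlen]) fun i h1 h2 => ?_
    simp [substring, x, h, h2]
  obtain ⟨A, hA, h⟩ := H N hN ((strings s).toFinset.filter fun σ => (G σ N).isSome) x
  refine ⟨A, hA, ?_⟩
  rw [length_filter_outputs, countP_strings]
  calc _ ≤ _ := Nat.mul_le_mul_left _ (Finset.card_le_card ?_)
    _ ≤ _ := h
    _ ≤ (strings s).toFinset.card := Finset.card_filter_le _ _
    _ ≤ (strings s).length := List.toFinset_card_le _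
    _ = 2 ^ s := length_strings s
  intro σ hσ
  simp only [Finset.mem_filter] at hσ ⊢
  obtain ⟨h1, h2⟩ := hσ
  obtain ⟨y, hy, hy'⟩ := (Option.any_eq_true _ _).1 h2
  refine ⟨⟨h1, by simp [hy]⟩, ?_⟩
  rw [← meetsString_substring_iff, hx hy]
  simpa using hy'

/-! ### The fair coin measure -/

instance : MeasureTheory.IsProbabilityMeasure coinMeasure := by
  unfold coinMeasure
  infer_instance

theorem substring_zero_eq_iff {ω : BinSeq} {σ : List Bool} :
    substring ω 0 σ.length = σ ↔
      ω ∈ Set.pi (Finset.range σ.length : Set ℕ) fun i => {σ.getD i false} := by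
  constructor
  · intro h i hi
    have hi : i < σ.length := by simpa using hi
    have h1 := congrArg (fun l => l.getD i false) h
    simpa [substring, hi] using h1
  · intro h
    refine List.ext_getElem (length_substring _ _ _) fun i h1 h2 => ?_
    have := h i (by simpa using h2)
    simpa [substring, h2] using this

theorem measurableSet_prefix (σ : List Bool) :
    MeasurableSet {ω : BinSeq | substring ω 0 σ.length = σ} := by
  simp only [substring_zero_eq_iff, Set.ofPred_mem_eq]
  exact MeasurableSet.pi (Finset.countable_toSet _) fun i _ => MeasurableSet.singleton _

theorem coinMeasure_prefix (σ : List Bool) :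
    coinMeasure {ω : BinSeq | substring ω 0 σ.length = σ} = 2⁻¹ ^ σ.length := by
  simp only [substring_zero_eq_iff, Set.ofPred_mem_eq]
  rw [coinMeasure, MeasureTheory.Measure.infinitePi_pi _ fun i _ => MeasurableSet.singleton _]
  have h : ∀ b : Bool, (PMF.uniformOfFintype Bool).toMeasure {b} = 2⁻¹ := by
    intro b
    rw [PMF.toMeasure_apply_singleton _ _ (MeasurableSet.singleton _)]
    simp
  simp [h]

theorem setOf_substring_eq_biUnion (s : ℕ) (P : List Bool → Bool) :
    {ω : BinSeq | P (substring ω 0 s)} = ⋃ σ ∈ (strings s).toFinset.filter fun σ => P σ,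
      {ω : BinSeq | substring ω 0 σ.length = σ} := by
  ext ω
  simp only [Set.mem_ofPred_eq, Set.mem_iUnion, Finset.mem_filter, List.mem_toFinset, mem_strings,
    exists_prop]
  constructor
  · intro h
    exact ⟨substring ω 0 s, ⟨length_substring _ _ _, h⟩, by rw [length_substring]⟩
  · rintro ⟨σ, ⟨rfl, h⟩, h2⟩
    rwa [h2]

theorem measurableSet_setOf_substring (s : ℕ) (P : List Bool → Bool) :
    MeasurableSet {ω : BinSeq | P (substring ω 0 s)} := by
  rw [setOf_substring_eq_biUnion]
  exact Finset.measurableSet_biUnion _ fun σ _ => measurableSet_prefix σ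

theorem coinMeasure_real_setOf_substring (s : ℕ) (P : List Bool → Bool) :
    coinMeasure.real {ω : BinSeq | P (substring ω 0 s)} = (strings s).countP P / 2 ^ s := by
  rw [setOf_substring_eq_biUnion, MeasureTheory.measureReal_biUnion_finset, countP_strings]
  · rw [Finset.sum_congr rfl (g := fun _ => (2 ^ s : ℝ)⁻¹)]
    · rw [Finset.sum_const, nsmul_eq_mul, div_eq_mul_inv]
    · intro σ hσ
      simp only [Finset.mem_filter, List.mem_toFinset, mem_strings] at hσ
      rw [MeasureTheory.measureReal_def, coinMeasure_prefix, hσ.1]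
      simp
  · intro σ hσ σ' hσ' hne
    simp only [Finset.coe_filter, List.mem_toFinset, mem_strings, Set.mem_ofPred_eq] at hσ hσ'
    refine Set.disjoint_left.2 fun ω h h' => hne ?_
    simp only [Set.mem_ofPred_eq] at h h'
    rw [← h, ← h', hσ.1, hσ'.1]
  · exact fun σ _ => measurableSet_prefix σ

/-- There are countably many tests, and each captures a null set. -/
theorem coinMeasure_compl_martinLofRandom : coinMeasure martinLofRandomᶜ = 0 := by
  have h : martinLofRandomᶜ ⊆ ⋃ W ∈ {W | IsMartinLofTest W}, ⋂ n, openSet (W n) := by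
    intro ω hω
    simp only [martinLofRandom, Set.mem_compl_iff, Set.mem_ofPred_eq, not_forall, not_exists,
      not_not] at hω
    obtain ⟨W, hW, h⟩ := hω
    exact Set.mem_biUnion hW (Set.mem_iInter.2 h)
  refine MeasureTheory.measure_mono_null h
    ((MeasureTheory.measure_biUnion_null_iff countable_setOf_isMartinLofTest).2 fun W hW => ?_)
  refine le_antisymm (ge_of_tendsto'
    (ENNReal.tendsto_pow_atTop_nhds_zero_of_lt_one (r := 2⁻¹) (by simp)) fun n => ?_) bot_le
  exact (MeasureTheory.measure_mono (Set.iInter_subset _ n)).trans (hW.measure_le n)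

/-! ### Functionals do not produce everywhere complex sequences -/

/-- A sparse list with short descriptions contains no string that occurs in an everywhere complex
sequence. -/
theorem not_meets_of_complex {U : List Bool →. List Bool} {τ : BinSeq} {M c c' t N : ℕ}
    (hM : 0 < M) {A : List (List Bool)} (hA : IsSparse M t A)
    (hτ : ∀ k n : ℕ, n ≤ M * (complexity U (substring τ k n) + c))
    (hU : ∀ i k : ℕ, ∀ x : List Bool, A[i]? = some x → i < 2 ^ k → complexity U x ≤ t + k + c')
    (ht : c + c' < t) : ¬ Meets τ N A := by
  rintro ⟨a, ha, hmem⟩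
  obtain ⟨k, -, hk⟩ := mem_factors.1 hmem
  obtain ⟨i, hi, rfl⟩ := List.mem_iff_getElem.1 ha
  have h1 := hA i hi
  rw [List.getD_eq_getElem _ _ hi] at h1
  have h2 := hτ k A[i].length
  rw [hk] at h2
  have h3 := hU i (A[i].length / M - 2 * t) _ (List.getElem?_eq_getElem hi) (by omega)
  set e := A[i].length / M - 2 * t with he
  -- The `i + 1` in `IsSparse` excludes `e = 0`, so the subtraction in `e` is not truncated.
  have he0 : e ≠ 0 := by
    intro h
    rw [h] at h1
    omega
  have h4 : A[i].length / M = e + 2 * t := by omega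
  have h5 := Nat.mul_div_le A[i].length M
  rw [h4] at h5
  have h6 := Nat.le_of_mul_le_mul_left (h5.trans h2) hM
  -- Now `e + 2 * t ≤ K(a) + c ≤ t + e + c' + c`, against `c + c' < t`.
  omega

/-- Here `C N s` collects the oracles that yield `N` symbols within `s` steps, and `D N` those that
ever do. The set `E` need not be measurable: only monotonicity and subadditivity are applied to it.
-/
theorem IsFunctional.measure_complex_eq_zero {U : List Bool →. List Bool} (hU : IsOptimal U)
    {G : List Bool → ℕ → Option (List Bool)} (hG : IsFunctional G) {M : ℕ} (hM : 0 < M) (c : ℕ) :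
    coinMeasure {ω | ∃ τ : BinSeq,
      (∀ k n : ℕ, n ≤ M * (complexity U (substring τ k n) + c)) ∧
      ∀ N, ∃ k, G (substring ω 0 k) N = some (substring τ 0 N)} = 0 := by
  set E := {ω | ∃ τ : BinSeq,
      (∀ k n : ℕ, n ≤ M * (complexity U (substring τ k n) + c)) ∧
      ∀ N, ∃ k, G (substring ω 0 k) N = some (substring τ 0 N)} with hE
  let μ := coinMeasure
  let C : ℕ → ℕ → Set BinSeq := fun N s => {ω | (G (substring ω 0 s) N).isSome}
  let D : ℕ → Set BinSeq := fun N => ⋃ s, C N s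
  have hCm : ∀ N s, MeasurableSet (C N s) := fun N s =>
    measurableSet_setOf_substring s fun σ => (G σ N).isSome
  have hCmono : ∀ N, Monotone (C N) := by
    intro N s s' hs ω hω
    obtain ⟨x, hx⟩ := Option.isSome_iff_exists.1 hω
    exact Option.isSome_iff_exists.2 ⟨x, hG.mono (substring_zero_prefix ω hs) hx⟩
  have hDanti : Antitone D := fun N N' hN =>
    Set.iUnion_mono fun s ω hω => hG.isSome_of_le hN hω
  have hED : ∀ N, E ⊆ D N := by
    rintro N ω ⟨τ, -, h⟩
    obtain ⟨k, hk⟩ := h N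
    exact Set.mem_iUnion.2 ⟨k, by simp [C, hk]⟩
  by_contra hne
  have hη : 0 < μ.real E := ENNReal.toReal_pos hne (MeasureTheory.measure_ne_top _ _)
  set η := μ.real E with hηdef
  let p : ℝ := ⨅ N, μ.real (D N)
  have hbdd : BddBelow (Set.range fun N => μ.real (D N)) :=
    ⟨0, by rintro _ ⟨N, rfl⟩; exact MeasureTheory.measureReal_nonneg⟩
  have hηp : η ≤ p := le_ciInf fun N => MeasureTheory.measureReal_mono (hED N)
  -- The limit `p` need not be computable, but one rational close to it can be built into the
  -- search.
  obtain ⟨r, hr1, hr2⟩ := exists_rat_btwn (show p - η / 4 < p by linarith)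
  have hr0 : (0 : ℝ) < r := by linarith
  have hr0' : 0 < r.num := Rat.num_pos.2 (by exact_mod_cast hr0)
  obtain ⟨a, ha⟩ := Int.eq_ofNat_of_zero_le hr0'.le
  have hrab : (r : ℝ) = a / r.den := by
    rw [Rat.cast_def, ha]
    simp
  have hden : (0 : ℝ) < r.den := by exact_mod_cast r.den_pos
  obtain ⟨d, hd⟩ := exists_pow_lt_of_lt_one (show 0 < η / 4 by linarith)
    (show (1 / 2 : ℝ) < 1 by norm_num)
  have hcount : ∀ N s, μ.real (C N s) = (outputs G N s).length / 2 ^ s := by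
    intro N s
    rw [length_outputs]
    exact coinMeasure_real_setOf_substring s fun σ => (G σ N).isSome
  -- Since `r < p`, the proportion of oracles that yield `N` symbols exceeds `r` at some finite
  -- stage `s`.
  have hex : ∀ t, ∃ w, IsWitness G a r.den d M t w := by
    intro t
    obtain ⟨N₀, H⟩ := hG.exists_sparse_meeting hM t d
    have h1 : ENNReal.ofReal r < μ (D (max t N₀)) := by
      rw [ENNReal.ofReal_lt_iff_lt_toReal hr0.le (MeasureTheory.measure_ne_top _ _)]
      exact hr2.trans_le (ciInf_le hbdd _)
    rw [(hCmono _).measure_iUnion] at h1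
    obtain ⟨s, hs⟩ := lt_iSup_iff.1 h1
    rw [ENNReal.ofReal_lt_iff_lt_toReal hr0.le (MeasureTheory.measure_ne_top _ _)] at hs
    change _ < μ.real _ at hs
    rw [hcount, hrab, div_lt_div_iff₀ hden (by positivity)] at hs
    obtain ⟨A, hA1, hA2⟩ := H _ (le_max_right t N₀) s
    refine ⟨(max t N₀, s, A), ⟨le_max_left _ _, ?_⟩, hA1, hA2⟩
    rw [mul_comm r.den]
    exact_mod_cast hs.le
  obtain ⟨f, hf, hfw⟩ := exists_computable_choice (hG.primrecRel_isWitness a r.den d M) hex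
  obtain ⟨c', hc'⟩ := hU.exists_complexity_le
    (f := fun t => (f t).2.2) (Computable.snd.comp (Computable.snd.comp hf))
  obtain ⟨N₁, hN₁⟩ := exists_lt_of_ciInf_lt (show p < p + η / 4 by linarith)
  -- `N ≥ t ≥ N₁` brings `D N` within `η / 4` above `p`, and `t > c + c'` makes the descriptions too
  -- short for complex outputs.
  set t := max N₁ (c + c' + 1) with ht
  have hw := hfw t
  have hdesc : ∀ i k : ℕ, ∀ x : List Bool, (f t).2.2[i]? = some x → i < 2 ^ k →
      complexity U x ≤ t + k + c' := hc' t
  generalize f t = w at hw hdesc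
  obtain ⟨N, s, A⟩ := w
  obtain ⟨⟨hN, hab⟩, hA, hbad⟩ := hw
  change t ≤ N at hN
  let B : Set BinSeq := {ω | (G (substring ω 0 s) N).any fun x => ¬ MeetsString x A}
  -- The late oracles have measure below `η / 2` and those whose output avoids `A` below `η / 4`,
  -- less than `η` in total.
  have hcover : E ⊆ (D N \ C N s) ∪ B := by
    rintro ω hω
    by_cases hC : ω ∈ C N s
    · right
      obtain ⟨τ, hτ, hk⟩ := hω
      obtain ⟨x, hx⟩ := Option.isSome_iff_exists.1 hC
      obtain ⟨k, hk⟩ := hk N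
      have h1 := hG.mono (substring_zero_prefix ω (le_max_left s k)) hx
      have h2 := hG.mono (substring_zero_prefix ω (le_max_right s k)) hk
      obtain rfl : x = substring τ 0 N := Option.some.inj (h1.symm.trans h2)
      have h3 := not_meets_of_complex (N := N) hM hA hτ hdesc (by omega)
      rw [← meetsString_substring_iff] at h3
      simp only [B, Set.mem_ofPred_eq, hx]
      simpa using h3
    · exact Or.inl ⟨hED N hω, hC⟩
  have hB : μ.real B ≤ (1 / 2) ^ d := by
    have : μ.real B = ((outputs G N s).filter fun x => ¬ MeetsString x A).length / 2 ^ s := by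
      rw [length_filter_outputs]
      exact coinMeasure_real_setOf_substring s fun σ =>
        (G σ N).any fun x => ¬ MeetsString x A
    rw [this, one_div, inv_pow, ← one_div, div_le_div_iff₀ (by positivity) (by positivity),
      mul_comm, one_mul]
    exact_mod_cast hbad
  have hC : p - η / 4 < μ.real (C N s) := by
    refine hr1.trans_le ?_
    rw [hcount, hrab, div_le_div_iff₀ hden (by positivity), mul_comm _ (r.den : ℝ)]
    exact_mod_cast hab
  have hD : μ.real (D N) < p + η / 4 :=
    (MeasureTheory.measureReal_mono (hDanti (by omega))).trans_lt hN₁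
  have hdiff : μ.real (D N \ C N s) = μ.real (D N) - μ.real (C N s) :=
    MeasureTheory.measureReal_sdiff (Set.subset_iUnion (C N) s) (hCm N s)
  have h1 : η ≤ μ.real (D N \ C N s) + μ.real B :=
    (MeasureTheory.measureReal_mono hcover).trans (MeasureTheory.measureReal_union_le _ _)
  linarith

/-- Everywhere complexity in terms of natural numbers. -/
theorem exists_nat_of_mem_everywhereComplex {U : List Bool →. List Bool} {τ : BinSeq}
    (h : τ ∈ everywhereComplex U) :
    ∃ M c : ℕ, ∀ k n : ℕ, n ≤ (M + 1) * (complexity U (substring τ k n) + c) := by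
  obtain ⟨α, h0, -, c, hc⟩ := h
  obtain ⟨M, hM⟩ := exists_nat_one_div_lt h0
  refine ⟨M, ⌈c⌉₊, fun k n => ?_⟩
  have h1 := hc k n
  have h2 := Nat.le_ceil c
  have h3 : (1 : ℝ) / (M + 1) * n ≤ α * n := mul_le_mul_of_nonneg_right hM.le n.cast_nonneg
  have h4 : (n : ℝ) / (M + 1) ≤ complexity U (substring τ k n) + ⌈c⌉₊ := by
    rw [div_eq_inv_mul, ← one_div]
    linarith
  rw [div_le_iff₀ (by positivity), mul_comm] at h4
  exact_mod_cast h4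

/-- Almost no sequence computes an everywhere complex sequence. -/
theorem measure_computes_everywhereComplex {U : List Bool →. List Bool} (hU : IsOptimal U) :
    coinMeasure {ω | ∃ τ ∈ everywhereComplex U, ComputableIn {toOracle ω} τ} = 0 := by
  refine MeasureTheory.measure_mono_null (t := ⋃ G ∈ {G | IsFunctional G}, ⋃ M : ℕ, ⋃ c : ℕ,
    {ω | ∃ τ : BinSeq, (∀ k n : ℕ, n ≤ (M + 1) * (complexity U (substring τ k n) + c)) ∧
      ∀ N, ∃ k, G (substring ω 0 k) N = some (substring τ 0 N)}) ?_ ?_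
  · rintro ω ⟨τ, hτ, hcomp⟩
    obtain ⟨M, c, h⟩ := exists_nat_of_mem_everywhereComplex hτ
    obtain ⟨G, hG, hk⟩ := exists_functional hcomp
    exact Set.mem_biUnion hG (Set.mem_iUnion.2 ⟨M, Set.mem_iUnion.2 ⟨c, τ, h, hk⟩⟩)
  · refine (MeasureTheory.measure_biUnion_null_iff countable_setOf_isFunctional).2 fun G hG => ?_
    exact MeasureTheory.measure_iUnion_null fun M => MeasureTheory.measure_iUnion_null fun c =>
      hG.measure_complex_eq_zero hU M.succ_pos c

end KolmogorovRandom

end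

theorem mainTheorem5 (U : List Bool →. List Bool) (hU : KolmogorovRandom.IsOptimal U) :
    ¬ KolmogorovRandom.MuchnikReducible
      (KolmogorovRandom.everywhereComplex U) KolmogorovRandom.martinLofRandom := by
  intro h
  have huniv : (Set.univ : Set KolmogorovRandom.BinSeq) ⊆ KolmogorovRandom.martinLofRandomᶜ ∪
      {ω | ∃ τ ∈ KolmogorovRandom.everywhereComplex U,
        ComputableIn {KolmogorovRandom.toOracle ω} τ} := by
    intro ω _
    by_cases hω : ω ∈ KolmogorovRandom.martinLofRandom
    · exact Or.inr (h ω hω)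
    · exact Or.inl hω
  have h0 := MeasureTheory.measure_mono_null huniv (MeasureTheory.measure_union_null
    KolmogorovRandom.coinMeasure_compl_martinLofRandom
    (KolmogorovRandom.measure_computes_everywhereComplex hU))
  rw [MeasureTheory.measure_univ] at h0
  exact one_ne_zero h0
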